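/- Write $\{e\}^D$ for the partial function computed by the $e$-th oracle program with oracle $D\subseteq\omega$, and let Kleene's $\mathcal O$ be the set of all $e$ such that $\{e\}^{\emptyset}$ is (the characteristic function of) a binary relation that well-orders $\omega$. A computable structure is a structure with domain $\omega$ in a computable first-order signature whose relations and functions are uniformly computable; $\mathcal M_i$ denotes the computable structure with index $i$ (not every $i$ need be an index). A Turing degree $\mathbf d$ is \emph{high for isomorphism} if for any two isomorphic computable structures $\mathcal M\cong\mathcal N$ (in the same signature) there is a $\mathbf d$-computable isomorphism from $\mathcal M$ to $\mathcal N$. It is \emph{uniformly high for isomorphism} if there are a $D\in\mathbf d$ and a total computable function $f$ such that for any computable structures $\mathcal M_i\cong\mathcal M_j$ the function $\{f(i,j)\}^D$ is an isomorphism from $\mathcal M_i$ to $\mathcal M_j$. Proposition. Kleene's $\mathcal O$ is arithmetical over any degree that is high (or uniformly high) for isomorphism. Furthermore: (1) If $\mathbf d$ is high for isomorphism, then $\mathcal O$ is $\Pi^0_3(\mathbf d)$, and thus $\mathbf d^{(3)}\ge\mathcal O$. (2) If $\mathbf d$ is uniformly high for isomorphism, then $\mathcal O$ is $\Sigma^0_2(\mathbf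 d)$, and thus $\mathbf d^{(2)}\ge\mathcal O$. -/

import Mathlib

namespace HighIso

open FirstOrder

/-! ### Sets of natural numbers as oracles, Turing degrees -/

open Classical in
/-- The characteristic function of a set of natural numbers, as a (total) oracle. -/
noncomputable def chi (A : Set ℕ) : ℕ →. ℕ := fun n => Part.some (if n ∈ A then 1 else 0)

/-- `A ≤_T B` for sets of natural numbers. -/
def SetReducible (A B : Set ℕ) : Prop := TuringReducible (chi A) (chi B)

/-- Turing equivalence of sets of natural numbers. -/
noncomputable def setTuringSetoid : Setoid (Set ℕ) :=
  Setoid.comap chi (AntisymmRel.setoid (ℕ →. ℕ) TuringReducible)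

/-- Turing degrees: the Turing equivalence classes of sets of natural numbers. -/
def Degree : Type := Quotient setTuringSetoid

/-- The degree of a set. -/
noncomputable def deg (D : Set ℕ) : Degree := Quotient.mk setTuringSetoid D

/-- `D ∈ d`: the set `D` is a member of the equivalence class `d`. -/
instance : Membership (Set ℕ) Degree := ⟨fun d D => deg D = d⟩

/-- The function `h` is computable from the degree `d`. -/
def Degree.Computes (d : Degree) (h : ℕ → ℕ) : Prop := ∃ D ∈ d, ComputableIn {chi D} h

/-! ### Oracle programs and their numbering -/

/-- Programs for the functions that are partial recursive in an oracle; the constructors are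
those of `Nat.RecursiveIn`. -/
inductive OCode : Type
  | zero : OCode
  | succ : OCode
  | left : OCode
  | right : OCode
  | oracle : OCode
  | pair : OCode → OCode → OCode
  | comp : OCode → OCode → OCode
  | prec : OCode → OCode → OCode
  | rfind : OCode → OCode

/-- The partial function computed by a program with oracle `g`. -/
def OCode.eval (g : ℕ →. ℕ) : OCode → ℕ →. ℕ
  | zero => fun _ => 0
  | succ => Nat.succ
  | left => fun n => (Nat.unpair n).1
  | right => fun n => (Nat.unpair n).2
  | oracle => g
  | pair a b => fun n => Nat.pair <$> a.eval g n <*> b.eval g n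
  | comp a b => fun n => b.eval g n >>= a.eval g
  | prec a b => fun p =>
      let (x, n) := Nat.unpair p
      n.rec (a.eval g x) fun y IH => do
        let i ← IH
        b.eval g (Nat.pair x (Nat.pair y i))
  | rfind a => fun x => Nat.rfind fun n => (fun m => m = 0) <$> a.eval g (Nat.pair x n)

/-- The number of a program. -/
def OCode.toNat : OCode → ℕ
  | zero => 0
  | succ => 1
  | left => 2
  | right => 3
  | oracle => 4
  | pair a b => 2 * (2 * Nat.pair a.toNat b.toNat) + 5
  | comp a b => 2 * (2 * Nat.pair a.toNat b.toNat + 1) + 5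
  | prec a b => (2 * (2 * Nat.pair a.toNat b.toNat) + 1) + 5
  | rfind a => (2 * (2 * a.toNat + 1) + 1) + 5

/-- The program with a given number. -/
def OCode.ofNat : ℕ → OCode
  | 0 => zero
  | 1 => succ
  | 2 => left
  | 3 => right
  | 4 => oracle
  | n + 5 =>
    let m := n.div2.div2
    have hm : m < n + 5 := by
      simp only [m, Nat.div2_val]
      omega
    have _m1 : n.div2.div2.unpair.1 < n + 5 := lt_of_le_of_lt m.unpair_left_le hm
    have _m2 : n.div2.div2.unpair.2 < n + 5 := lt_of_le_of_lt m.unpair_right_le hm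
    match n.bodd, n.div2.bodd with
    | false, false => pair (ofNat m.unpair.1) (ofNat m.unpair.2)
    | false, true => comp (ofNat m.unpair.1) (ofNat m.unpair.2)
    | true, false => prec (ofNat m.unpair.1) (ofNat m.unpair.2)
    | true, true => rfind (ofNat m)
termination_by n => n

theorem OCode.ofNat_toNat (c : OCode) : ofNat c.toNat = c := by
  induction c <;> simp_all [toNat, ofNat, Nat.div2_val]

/-- `{e}^D`: the partial function computed by the `e`-th oracle program with oracle `D`. -/
noncomputable def phi (D : Set ℕ) (e : ℕ) : ℕ →. ℕ := (OCode.ofNat e).eval (chi D)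

/-- The `{e}^D` are exactly the partial functions that are recursive in `D`. -/
theorem recursiveIn_iff_exists_phi (D : Set ℕ) (f : ℕ →. ℕ) :
    RecursiveIn {chi D} f ↔ ∃ e, phi D e = f := by
  rw [RecursiveIn.iff_nat]
  constructor
  · intro h
    suffices H : ∃ c : OCode, c.eval (chi D) = f by
      obtain ⟨c, hc⟩ := H
      exact ⟨c.toNat, by rw [phi, OCode.ofNat_toNat, hc]⟩
    induction h with
    | zero => exact ⟨.zero, rfl⟩
    | succ => exact ⟨.succ, rfl⟩
    | left => exact ⟨.left, rfl⟩
    | right => exact ⟨.right, rfl⟩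
    | oracle g hg => exact ⟨.oracle, hg.symm⟩
    | pair _ _ ha hb =>
      obtain ⟨a, rfl⟩ := ha
      obtain ⟨b, rfl⟩ := hb
      exact ⟨.pair a b, rfl⟩
    | comp _ _ ha hb =>
      obtain ⟨a, rfl⟩ := ha
      obtain ⟨b, rfl⟩ := hb
      exact ⟨.comp a b, rfl⟩
    | prec _ _ ha hb =>
      obtain ⟨a, rfl⟩ := ha
      obtain ⟨b, rfl⟩ := hb
      exact ⟨.prec a b, rfl⟩
    | rfind _ ha =>
      obtain ⟨a, rfl⟩ := ha
      exact ⟨.rfind a, rfl⟩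
  · rintro ⟨e, rfl⟩
    unfold phi
    generalize OCode.ofNat e = c
    induction c with
    | zero => exact .zero
    | succ => exact .succ
    | left => exact .left
    | right => exact .right
    | oracle => exact .oracle _ rfl
    | pair a b ha hb => exact .pair ha hb
    | comp a b ha hb => exact .comp ha hb
    | prec a b ha hb => exact .prec ha hb
    | rfind a ha => exact .rfind ha

/-! ### Jumps, the arithmetical hierarchy over an oracle, Kleene's `O` -/

/-- The Turing jump `D' = {e : {e}^D(e) is defined}`. -/
def jump (D : Set ℕ) : Set ℕ := {e | (phi D e e).Dom}

/-- `A` is `Σ^0_n(D)`. Here `A` is `Σ^0_{n+1}(D)` if it is the projection of a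
`Π^0_n(D)` set of pairs, that is, of a set whose complement is `Σ^0_n(D)`. -/
def IsSigma (D : Set ℕ) : ℕ → Set ℕ → Prop
  | 0, A => SetReducible A D
  | n + 1, A => ∃ B : Set ℕ, IsSigma D n Bᶜ ∧ ∀ x, x ∈ A ↔ ∃ y, Nat.pair x y ∈ B

/-- `A` is `Π^0_n(D)`. -/
def IsPi (D : Set ℕ) (n : ℕ) (A : Set ℕ) : Prop := IsSigma D n Aᶜ

/-- `A` is arithmetical over `D`. -/
def IsArithmeticalOver (D A : Set ℕ) : Prop := ∃ n, IsSigma D n A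

open Classical in
/-- Kleene's `O` relative to `X`: the set of `e` such that `{e}^X` is the characteristic function
of a (strict) well-ordering of `ω`. -/
def kleeneORel (X : Set ℕ) : Set ℕ :=
  {e | ∃ r : ℕ → ℕ → Prop, IsWellOrder ℕ r ∧
    ∀ a b, phi X e (Nat.pair a b) = Part.some (if r a b then 1 else 0)}

/-- Kleene's `O`. -/
def kleeneO : Set ℕ := kleeneORel ∅

/-! ### Computable structures -/

/-- A countable first-order signature with symbols numbered by natural numbers: `relArity k = some n`
means that `k` is (the number of) an `n`-ary relation symbol, `relArity k = none` that `k` is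
not a relation symbol; likewise for function symbols, where arity `0` gives constants. -/
structure Signature where
  relArity : ℕ → Option ℕ
  funArity : ℕ → Option ℕ

/-- The first-order language of a signature. -/
def Signature.language (S : Signature) : Language where
  Functions n := {k // S.funArity k = some n}
  Relations n := {k // S.relArity k = some n}

/-- An `S`-structure with domain `ω`. -/
abbrev Str (S : Signature) : Type := S.language.Structure ℕ

/-- Interpretation of the function symbols: `(k, v)` is sent to the value of the `k`-th function
symbol at the tuple `v`, and is outside the domain if `k` is not a symbol of arity `|v|`. -/
def Str.funEval {S : Signature} (M : Str S) : ℕ × List ℕ →. ℕ := fun p =>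
  if h : S.funArity p.1 = some p.2.length then
    Part.some (M.funMap (n := p.2.length) ⟨p.1, h⟩ p.2.get)
  else Part.none

open Classical in
/-- Interpretation of the relation symbols: `(k, v)` is sent to the truth value of the `k`-th
relation symbol at the tuple `v`, and is outside the domain if `k` is not a symbol of
arity `|v|`. -/
noncomputable def Str.relEval {S : Signature} (M : Str S) : ℕ × List ℕ →. Bool := fun p =>
  if h : S.relArity p.1 = some p.2.length then
    Part.some (decide (M.RelMap (n := p.2.length) ⟨p.1, h⟩ p.2.get))
  else Part.none

/-- A computable structure: its signature is computable and its operations and relations are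
uniformly computable. -/
def Str.IsComputable {S : Signature} (M : Str S) : Prop :=
  Computable S.relArity ∧ Computable S.funArity ∧ Partrec M.relEval ∧ Partrec M.funEval

/-- The program `c` computes the partial function `f`. -/
def CodeComputes {α σ : Type} [Primcodable α] [Primcodable σ] (c : Nat.Partrec.Code)
    (f : α →. σ) : Prop :=
  c.eval = fun n => Part.bind (Encodable.decode (α := α) n) fun a => (f a).map Encodable.encode

/-- `M = M_i`: the number `i` codes four programs, which compute the arities of the relation symbols,
the arities of the function symbols, the relations and the operations of `M`. -/
def Str.IsIndex {S : Signature} (M : Str S) (i : ℕ) : Prop :=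
  ∃ a b c e : Nat.Partrec.Code, Encodable.encode (a, b, c, e) = i ∧
    CodeComputes a (S.relArity : ℕ →. Option ℕ) ∧ CodeComputes b (S.funArity : ℕ →. Option ℕ) ∧
    CodeComputes c M.relEval ∧ CodeComputes e M.funEval

/-- The computable structures are those in the list `M_0, M_1, …`. -/
theorem Str.isComputable_iff_exists_index {S : Signature} (M : Str S) :
    M.IsComputable ↔ ∃ i, M.IsIndex i := by
  have key : ∀ {α σ : Type} [Primcodable α] [Primcodable σ] (f : α →. σ),
      Partrec f ↔ ∃ c, CodeComputes c f := fun f => Nat.Partrec.Code.exists_code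
  unfold Str.IsComputable Computable
  rw [key, key, key, key]
  constructor
  · rintro ⟨⟨a, ha⟩, ⟨b, hb⟩, ⟨c, hc⟩, ⟨e, he⟩⟩
    exact ⟨_, a, b, c, e, rfl, ha, hb, hc, he⟩
  · rintro ⟨_, a, b, c, e, _, ha, hb, hc, he⟩
    exact ⟨⟨a, ha⟩, ⟨b, hb⟩, ⟨c, hc⟩, ⟨e, he⟩⟩

/-- Isomorphisms from `M` to `N`. -/
abbrev Iso {S : Signature} (M N : Str S) : Type := @Language.Equiv S.language ℕ ℕ M N

/-- An isomorphism as a function on natural numbers. -/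
def Iso.toFun {S : Signature} {M N : Str S} (g : Iso M N) : ℕ → ℕ :=
  (@Language.Equiv.toEquiv S.language ℕ ℕ M N g : ℕ ≃ ℕ)

/-! ### Highness for isomorphism -/

/-- The degree `d` is high for isomorphism: any two isomorphic computable structures have a
`d`-computable isomorphism. -/
def Degree.IsHighForIsomorphism (d : Degree) : Prop :=
  ∀ (S : Signature) (M N : Str S), M.IsComputable → N.IsComputable → Nonempty (Iso M N) →
    ∃ g : Iso M N, d.Computes g.toFun

/-- The degree `d` is uniformly high for isomorphism: for some `D ∈ d` and some total computable `f`,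
whenever `M_i` and `M_j` are isomorphic, `{f(i,j)}^D` is an isomorphism from `M_i` to `M_j`. -/
def Degree.IsUniformlyHighForIsomorphism (d : Degree) : Prop :=
  ∃ D ∈ d, ∃ f : ℕ → ℕ → ℕ, Computable₂ f ∧
    ∀ (i j : ℕ) (S : Signature) (M N : Str S), M.IsIndex i → N.IsIndex j → Nonempty (Iso M N) →
      ∃ g : Iso M N, phi D (f i j) = (g.toFun : ℕ →. ℕ)

end HighIso

/-! That `e` lies outside `O` means that some pair never receives a usable value or that the
relation has an infinite descending sequence. Both kinds of failure are infinite chains for one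
primitive recursive relation, `refutationStep e`, that is, infinite paths through a computable tree
(`not_mem_kleeneO_of_refutation`, `exists_refutation_of_not_mem_kleeneO`).

The tree is turned into two computable structures. Over each node lies a copy of the finite sets of
numbers, a group under symmetric difference. Relations tie a digit at a node to the parity at the
corresponding child, and the two structures differ only in which parity is marked over the root. The
images of the zeros under an isomorphism form an odd labelling: finitely many children are chosen at
each node, an odd number at the root and at exactly the chosen nodes (`isOddLabelling_of_iso`). A
path gives such a labelling, hence an isomorphism (`nonempty_iso_fibreStr`). Conversely an odd set
is nonempty, so repeatedly taking the least chosen child computes a path from an isomorphism.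

Hence `e` is outside `O` iff some program with oracle `D` yields a path. The check is sound for
every program, whether or not it computes an isomorphism (`not_mem_kleeneO_of_pathCheck`). Success
at every depth is a `Π_2(D)` condition, by the use principle and an enumeration theorem for oracle
programs. The quantifier over programs makes the complement of `O` a `Σ_3(D)` set. In the uniform
case the program is a computable function of `e`, the quantifier disappears, and the complement is
`Π_2(D)`. -/

namespace HighIso

open Filter

/-! ### Oracle programs: monotonicity, use principle, uniform translation -/

/-- If the oracles `h s` approximate `g` along `l`, then every value with oracle `g` is eventually
a value with oracle `h s`. -/
theorem OCode.eval_eventually {g : ℕ →. ℕ} {ι : Type*} {l : Filter ι} {h : ι → ℕ →. ℕ}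
    (H : ∀ n y, y ∈ g n → ∀ᶠ s in l, y ∈ h s n) (c : OCode) {n y : ℕ}
    (hy : y ∈ c.eval g n) : ∀ᶠ s in l, y ∈ c.eval (h s) n := by
  induction c generalizing n y with
  | zero | succ | left | right => exact Eventually.of_forall fun _ => hy
  | oracle => exact H n y hy
  | pair a b iha ihb =>
    simp only [eval, Seq.seq, Part.map_eq_map, Part.mem_bind_iff, Part.mem_map_iff] at hy ⊢
    obtain ⟨f, ⟨u, hu, rfl⟩, v, hv, rfl⟩ := hy
    filter_upwards [iha hu, ihb hv] with s hu hv
    exact ⟨_, ⟨u, hu, rfl⟩, v, hv, rfl⟩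
  | comp a b iha ihb =>
    obtain ⟨u, hu, hv⟩ := Part.mem_bind_iff.1 hy
    filter_upwards [ihb hu, iha hv] with s hu hv
    exact Part.mem_bind_iff.2 ⟨u, hu, hv⟩
  | prec a b iha ihb =>
    simp only [eval, Part.bind_eq_bind] at hy ⊢
    generalize n.unpair.2 = k at hy ⊢
    induction k generalizing y with
    | zero => exact iha hy
    | succ k ih =>
      simp only [Part.mem_bind_iff] at hy ⊢
      obtain ⟨u, hu, hv⟩ := hy
      filter_upwards [ih hu, ihb hv] with s hu hv
      exact ⟨u, hu, hv⟩
  | rfind a iha =>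
    obtain ⟨hy, hlt⟩ := Nat.mem_rfind.1 hy
    obtain ⟨u, hu, hu'⟩ := (Part.mem_map_iff _).1 hy
    -- Only the finitely many arguments below `y` are tested before the search stops, so their
    -- thresholds have a common refinement.
    have hall : ∀ᶠ s in l, ∀ m ∈ Set.Iio y,
        ∃ v ∈ a.eval (h s) (Nat.pair n m), decide (v = 0) = false := by
      refine (eventually_all_finite (Set.finite_Iio y)).2 fun m hm => ?_
      obtain ⟨v, hv, hv'⟩ := (Part.mem_map_iff _).1 (hlt hm)
      filter_upwards [iha hv] with s hv using ⟨v, hv, hv'⟩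
    filter_upwards [iha hu, hall] with s hu hall
    exact Nat.mem_rfind.2 ⟨(Part.mem_map_iff _).2 ⟨u, hu, hu'⟩,
      fun {m} hm => (Part.mem_map_iff _).2 (hall m hm)⟩

/-- This is the approximation statement for a one-point index set, where "eventually" means "at that
point". -/
theorem OCode.eval_mono {g h : ℕ →. ℕ} (H : ∀ n y, y ∈ g n → y ∈ h n) (c : OCode) {n y : ℕ}
    (hy : y ∈ c.eval g n) : y ∈ c.eval h n :=
  eventually_pure.1 (c.eval_eventually (l := pure ()) (h := fun _ => h)
    (fun n y hy => eventually_pure.2 (H n y hy)) hy)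

/-- The partial oracle given by a finite list of values. -/
def oracleOf (L : List ℕ) : ℕ →. ℕ := fun n => (L[n]? : Option ℕ)

open Classical in
/-- The first `s` values of the characteristic function of `D`. -/
noncomputable def initialSegment (D : Set ℕ) (s : ℕ) : List ℕ :=
  (List.range s).map fun n => if n ∈ D then 1 else 0

theorem mem_chi_of_mem_initialSegment {D : Set ℕ} {s n y : ℕ}
    (h : y ∈ oracleOf (initialSegment D s) n) : y ∈ chi D n := by
  simp only [oracleOf, initialSegment, Part.mem_ofOption, Option.mem_def, List.getElem?_map,
    Option.map_eq_some_iff] at h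
  obtain ⟨m, hm, rfl⟩ := h
  obtain ⟨hlt, rfl⟩ := List.getElem?_eq_some_iff.1 hm
  rw [List.getElem_range]
  exact Part.mem_some _

theorem eventually_mem_initialSegment {D : Set ℕ} {n y : ℕ} (h : y ∈ chi D n) :
    ∀ᶠ s in atTop, y ∈ oracleOf (initialSegment D s) n := by
  filter_upwards [eventually_gt_atTop n] with s hs
  simp only [chi, Part.mem_some_iff] at h
  subst h
  simp [oracleOf, initialSegment, List.getElem?_range hs]

open Nat.Partrec (Code)

/-- Translation of oracle programs to programs, where `o` computes a uniform family of oracles. -/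
def OCode.trans (o : Code) : OCode → Code
  | zero => .zero
  | succ => .comp .succ .right
  | left => .comp .left .right
  | right => .comp .right .right
  | oracle => o
  | pair a b => .pair (a.trans o) (b.trans o)
  | comp a b => .comp (a.trans o) (.pair .left (b.trans o))
  -- The oracle index has to survive the recursion, so `(l, (x, n))` is regrouped as `((l, x), n)`
  -- and undone inside the step.
  | prec a b =>
    .comp (.prec (a.trans o)
        (.comp (b.trans o) (.pair (.comp .left .left) (.pair (.comp .right .left) .right))))
      (.pair (.pair .left (.comp .left .right)) (.comp .right .right))
  -- `rfind'` searches upward from a given start; the appended zero makes the search begin at `0`.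
  | rfind a =>
    .comp (.rfind' (.comp (a.trans o) (.pair (.comp .left .left) (.pair (.comp .right .left) .right))))
      (.pair .id .zero)

theorem _root_.Nat.Partrec.Code.eval_comp_of_eq {a b : Code} {n m : ℕ} (h : b.eval n = Part.some m) :
    (Code.comp a b).eval n = a.eval m := by
  change (b.eval n).bind a.eval = _
  rw [h]
  exact Part.bind_some _ _

theorem _root_.Nat.Partrec.Code.eval_pair_of_eq {a b : Code} {n x y : ℕ} (ha : a.eval n = Part.some x)
    (hb : b.eval n = Part.some y) : (Code.pair a b).eval n = Part.some (Nat.pair x y) := by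
  simp [Code.eval, Seq.seq, ha, hb]

theorem _root_.Nat.Partrec.Code.eval_left_pair (x y : ℕ) :
    Code.left.eval (Nat.pair x y) = Part.some x := by
  simp [Code.eval]

theorem _root_.Nat.Partrec.Code.eval_right_pair (x y : ℕ) :
    Code.right.eval (Nat.pair x y) = Part.some y := by
  simp [Code.eval]

open Nat.Partrec.Code in
theorem _root_.Nat.Partrec.Code.eval_assoc (x y z : ℕ) :
    (Code.pair (.comp .left .left) (.pair (.comp .right .left) .right)).eval
      (Nat.pair (Nat.pair x y) z) = Part.some (Nat.pair x (Nat.pair y z)) :=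
  eval_pair_of_eq ((eval_comp_of_eq (eval_left_pair _ _)).trans (eval_left_pair _ _))
    (eval_pair_of_eq ((eval_comp_of_eq (eval_left_pair _ _)).trans (eval_right_pair _ _))
      (eval_right_pair _ _))

open Nat.Partrec.Code in
theorem OCode.eval_trans {o : Code} {G : ℕ → ℕ →. ℕ} (ho : ∀ l n, o.eval (Nat.pair l n) = G l n)
    (c : OCode) (l n : ℕ) : (c.trans o).eval (Nat.pair l n) = c.eval (G l) n := by
  induction c generalizing n with
  | zero => rfl
  | succ | left | right =>
    rw [trans, eval_comp_of_eq (eval_right_pair _ _)]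
    rfl
  | oracle => exact ho l n
  | pair a b iha ihb => simp [trans, Code.eval, eval, iha, ihb]
  | comp a b iha ihb =>
    change ((Code.pair .left (b.trans o)).eval _).bind (a.trans o).eval = (b.eval _ n).bind _
    have : (Code.pair .left (b.trans o)).eval (Nat.pair l n) =
        (b.eval (G l) n).map (Nat.pair l) := by
      simp [Code.eval, Seq.seq, ihb]
    rw [this]
    exact (Part.bind_map _ _ _).trans (congrArg _ (funext iha))
  | prec a b iha ihb =>
    have h : (Code.pair (.pair .left (.comp .left .right)) (.comp .right .right)).eval
        (Nat.pair l n) = Part.some (Nat.pair (Nat.pair l n.unpair.1) n.unpair.2) :=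
      eval_pair_of_eq (eval_pair_of_eq (eval_left_pair _ _)
        ((eval_comp_of_eq (eval_right_pair _ _)).trans rfl))
        ((eval_comp_of_eq (eval_right_pair _ _)).trans rfl)
    rw [trans, eval_comp_of_eq h]
    simp only [eval]
    generalize n.unpair.2 = k
    induction k with
    | zero => exact (eval_prec_zero _ _ _).trans (iha _)
    | succ k ih =>
      rw [eval_prec_succ, ih]
      refine congrArg _ (funext fun i => ?_)
      rw [eval_comp_of_eq (eval_assoc _ _ _), ihb]
  | rfind a iha =>
    have h : (Code.pair .id .zero).eval (Nat.pair l n) =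
        Part.some (Nat.pair (Nat.pair l n) 0) := eval_pair_of_eq (eval_id _) rfl
    rw [trans, eval_comp_of_eq h]
    simp only [Code.eval, Nat.unpaired, Nat.unpair_pair, Nat.add_zero, eval]
    rw [show (fun x : ℕ => x) = id from rfl, show ∀ x : Part ℕ, x.map id = x from Part.map_id' fun _ => rfl]
    congr 1
    funext m
    refine congrArg _ ?_
    exact (eval_comp_of_eq (eval_assoc _ _ _)).trans (iha _)

-- Course-of-values recursion on the program number: the list holds the translations of all smaller
-- numbers. From `5` on, two low bits select the constructor and the remaining quotient gives the
-- subprograms.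
open Primrec in
theorem OCode.primrec_trans_ofNat (o : Code) : Primrec fun e => (OCode.ofNat e).trans o := by
  let G₁ : List Code × ℕ × ℕ → Option Code := fun p =>
    p.1[p.2.2]?.bind fun s =>
    p.1[p.2.2.unpair.1]?.bind fun s₁ =>
    p.1[p.2.2.unpair.2]?.map fun s₂ =>
    cond p.2.1.bodd
      (cond p.2.1.div2.bodd
        (.comp (.rfind' (.comp s (.pair (.comp .left .left) (.pair (.comp .right .left) .right))))
          (.pair .id .zero))
        (.comp (.prec s₁ (.comp s₂ (.pair (.comp .left .left) (.pair (.comp .right .left) .right))))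
          (.pair (.pair .left (.comp .left .right)) (.comp .right .right))))
      (cond p.2.1.div2.bodd (.comp s₁ (.pair .left s₂)) (.pair s₁ s₂))
  have hG₁ : Primrec G₁ :=
    option_bind (list_getElem?.comp fst (snd.comp snd)) <| .mk <|
    option_bind ((list_getElem?.comp fst
      (fst.comp <| Primrec.unpair.comp (snd.comp snd))).comp fst) <| .mk <|
    option_map ((list_getElem?.comp fst
      (snd.comp <| Primrec.unpair.comp (snd.comp snd))).comp <| fst.comp fst) <| .mk <|
    have n : Primrec fun x : (((List Code × ℕ × ℕ) × Code) × Code) × Code => x.1.1.1.2.1 :=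
      fst.comp (snd.comp <| fst.comp <| fst.comp fst)
    have s := snd.comp (fst.comp fst)
    have s₁ := snd.comp fst
    have s₂ := snd
    (nat_bodd.comp n).cond
      ((nat_bodd.comp <| nat_div2.comp n).cond
        (Code.primrec₂_comp.comp
          (Code.primrec_rfind'.comp (Code.primrec₂_comp.comp s (.const _))) (.const _))
        (Code.primrec₂_comp.comp
          (Code.primrec₂_prec.comp s₁ (Code.primrec₂_comp.comp s₂ (.const _))) (.const _)))
      ((nat_bodd.comp <| nat_div2.comp n).cond
        (Code.primrec₂_comp.comp s₁ (Code.primrec₂_pair.comp (.const _) s₂))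
        (Code.primrec₂_pair.comp s₁ s₂))
  let G : Unit → List Code → Option Code := fun _ IH =>
    IH.length.casesOn (some (OCode.zero.trans o)) fun n =>
    n.casesOn (some (OCode.succ.trans o)) fun n =>
    n.casesOn (some (OCode.left.trans o)) fun n =>
    n.casesOn (some (OCode.right.trans o)) fun n =>
    n.casesOn (some o) fun n =>
    G₁ (IH, n, n.div2.div2)
  have hG : Primrec₂ G := .mk <|
    nat_casesOn (list_length.comp snd) (.const _) <| .mk <|
    nat_casesOn snd (.const _) <| .mk <|
    nat_casesOn snd (.const _) <| .mk <|
    nat_casesOn snd (.const _) <| .mk <|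
    nat_casesOn snd (.const _) <| .mk <|
    hG₁.comp <| (snd.comp <| fst.comp <| fst.comp <| fst.comp <| fst.comp fst).pair <|
      snd.pair <| nat_div2.comp <| nat_div2.comp snd
  refine (nat_strong_rec (fun _ n => (OCode.ofNat n).trans o) hG fun _ n => ?_).comp
    (.const ()) .id
  iterate 5 rcases n with - | n; · simp only [G, List.length_map, List.length_range, Nat.zero_add, Nat.reduceAdd, ofNat]; rfl
  simp only [G, List.length_map, List.length_range]
  have hm : n.div2.div2 < n + 5 := by
    simp only [Nat.div2_val]
    omega
  have m1 : n.div2.div2.unpair.1 < n + 5 := lt_of_le_of_lt (Nat.unpair_left_le _) hm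
  have m2 : n.div2.div2.unpair.2 < n + 5 := lt_of_le_of_lt (Nat.unpair_right_le _) hm
  simp only [G₁, List.getElem?_map, List.getElem?_range, hm, m1, m2, Option.map_some,
    Option.bind_some, Option.some.injEq]
  rw [ofNat]
  cases n.bodd <;> cases n.div2.bodd <;> rfl

/-- The enumeration theorem for oracle programs over a uniform family of oracles. -/
theorem exists_primrec_code_eval {G : ℕ → ℕ →. ℕ} (hG : Partrec₂ G) :
    ∃ t : ℕ → Code, Primrec t ∧
      ∀ e l n, (t e).eval (Nat.pair l n) = (OCode.ofNat e).eval (G l) n := by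
  obtain ⟨o, ho⟩ := Code.exists_code.1 
    (Partrec.nat_iff.1 (hG.comp (Computable.fst.comp Computable.unpair)
      (Computable.snd.comp Computable.unpair)))
  refine ⟨_, OCode.primrec_trans_ofNat o, fun e l n => OCode.eval_trans (G := G) ?_ _ l n⟩
  intro l n
  simp [ho]

end HighIso

namespace HighIso

/-! ### Reducibility, the arithmetical hierarchy and jumps -/

theorem setReducible_of_computableIn {A D : Set ℕ} {g : ℕ → ℕ} (hg : ComputableIn {chi D} g)
    {p : ℕ → Bool} (hp : Computable p) (h : ∀ x, x ∈ A ↔ p (g x) = true) : SetReducible A D := by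
  have hc : Computable fun n => cond (p n) 1 0 := .cond hp (.const 1) (.const 0)
  have hg' := RecursiveIn.iff_nat.1 hg
  have hc' := RecursiveIn.iff_nat.1 (hc.computableIn (O := {chi D}))
  refine RecursiveIn.iff_nat.2 ((hc'.comp hg').of_eq fun n => ?_)
  refine (Part.bind_some _ _).trans ?_
  by_cases hn : n ∈ A
  · simp [chi, hn, (h n).1 hn]
  · simp [chi, hn, mt (h n).2 hn]

theorem SetReducible.trans {A B C : Set ℕ} (h : SetReducible A B) (h' : SetReducible B C) :
    SetReducible A C :=
  TuringReducible.trans h h'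

theorem SetReducible.compl {A D : Set ℕ} (h : SetReducible A D) : SetReducible Aᶜ D := by
  classical
  have hg : ComputableIn {chi D} fun n => if n ∈ A then 1 else 0 := by
    have : chi A = fun n => Part.some (if n ∈ A then 1 else 0) := by
      funext n; simp only [chi]
    rwa [SetReducible, TuringReducible, this] at h
  refine setReducible_of_computableIn hg (p := fun n => decide (n = 0))
    (Primrec.eq.decide.comp .id (.const 0)).to_comp fun x => ?_
  by_cases hx : x ∈ A <;> simp [hx]

theorem SetReducible.preimage {A D : Set ℕ} (h : SetReducible A D) {f : ℕ → ℕ}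
    (hf : Computable f) : SetReducible (f ⁻¹' A) D := by
  have hf' := RecursiveIn.iff_nat.1 (hf.computableIn (O := {chi D}))
  refine RecursiveIn.iff_nat.2 (((RecursiveIn.iff_nat.1 h).comp hf').of_eq fun n => ?_)
  exact Part.bind_some _ _

theorem IsSigma.mono {D E : Set ℕ} (hDE : SetReducible D E) {n : ℕ} {A : Set ℕ}
    (h : IsSigma D n A) : IsSigma E n A := by
  induction n generalizing A with
  | zero => exact SetReducible.trans h hDE
  | succ n ih =>
    obtain ⟨B, hB, hA⟩ := h
    exact ⟨B, ih hB, hA⟩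

theorem IsSigma.preimage {D : Set ℕ} {n : ℕ} {A : Set ℕ} (h : IsSigma D n A) {f : ℕ → ℕ}
    (hf : Computable f) : IsSigma D n (f ⁻¹' A) := by
  induction n generalizing A f with
  | zero => exact SetReducible.preimage h hf
  | succ n ih =>
    obtain ⟨B, hB, hA⟩ := h
    have hf' : Computable fun z : ℕ => Nat.pair (f z.unpair.1) z.unpair.2 :=
      Primrec₂.natPair.to_comp.comp (hf.comp (Computable.fst.comp Computable.unpair))
        (Computable.snd.comp Computable.unpair)
    refine ⟨(fun z : ℕ => Nat.pair (f z.unpair.1) z.unpair.2) ⁻¹' B, ih hB hf', fun x => ?_⟩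
    simpa using hA (f x)

theorem IsPi.isSigma_succ {D : Set ℕ} {n : ℕ} {A : Set ℕ} (h : IsPi D n A) :
    IsSigma D (n + 1) A :=
  ⟨(fun z => z.unpair.1) ⁻¹' A, h.preimage (Computable.fst.comp Computable.unpair), by simp⟩

/-- The program computing a constant function. -/
def OCode.const : ℕ → OCode
  | 0 => zero
  | n + 1 => comp succ (const n)

theorem OCode.eval_const (g : ℕ →. ℕ) (n m : ℕ) : (const n).eval g m = Part.some n := by
  induction n with
  | zero => rfl
  | succ n ih =>
    change ((const n).eval g m).bind (fun k => Part.some (k + 1)) = _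
    rw [ih]
    exact Part.bind_some _ _

/-- The parameter theorem needed for the jump: these programs ignore their input, so their halting
on their own number is the halting of `c` on `n`. -/
theorem OCode.primrec_toNat_comp_const (c : OCode) :
    Primrec fun n => (comp c (const n)).toNat := by
  have hcomp : Primrec₂ fun a b : ℕ => 2 * (2 * Nat.pair a b + 1) + 5 :=
    Primrec.nat_add.comp (Primrec.nat_mul.comp (.const 2)
      (Primrec.succ.comp (Primrec.nat_mul.comp (.const 2) Primrec₂.natPair))) (.const 5)
  have hconst : Primrec fun n => (const n).toNat := by
    refine (Primrec.nat_rec₁ 0 (hcomp.comp₂ (Primrec₂.const 1) Primrec₂.right)).of_eq fun n => ?_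
    induction n with
    | zero => rfl
    | succ n ih => simp only [const, toNat, ← ih]
  exact hcomp.comp (.const c.toNat) hconst

theorem IsSigma.setReducible_jump {X A : Set ℕ} (h : IsSigma X 1 A) : SetReducible A (jump X) := by
  obtain ⟨B, hB, hA⟩ := h
  -- A search for a zero of the characteristic function of `Bᶜ` is a search for a witness in `B`.
  obtain ⟨e, he⟩ := (recursiveIn_iff_exists_phi X _).1
    (RecursiveIn.iff_nat.2 (RecursiveIn.iff_nat.1 hB).rfind)
  have hdom : ∀ x, (phi X e x).Dom ↔ x ∈ A := by
    intro x
    rw [he, hA]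
    refine Nat.rfind_dom.trans ?_
    simp [chi]
  have hJ : SetReducible (jump X) (jump X) := TuringReducible.refl _
  convert hJ.preimage (OCode.primrec_toNat_comp_const (OCode.ofNat e)).to_comp using 1
  ext x
  rw [← hdom, Set.mem_preimage, jump, Set.mem_ofPred_eq, phi, phi, OCode.ofNat_toNat]
  change _ ↔ (((OCode.const x).eval _ _).bind ((OCode.ofNat e).eval (chi X))).Dom
  rw [OCode.eval_const]
  exact iff_of_eq (congrArg Part.Dom (Part.bind_some _ _).symm)

theorem IsSigma.setReducible_jump_iterate {D : Set ℕ} {n : ℕ} {A : Set ℕ} (h : IsSigma D n A) :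
    SetReducible A (jump^[n] D) := by
  induction n generalizing A with
  | zero => exact h
  | succ n ih =>
    obtain ⟨B, hB, hA⟩ := h
    rw [Function.iterate_succ_apply']
    exact IsSigma.setReducible_jump ⟨B, ih hB, hA⟩

theorem computableIn_initialSegment (D : Set ℕ) :
    ComputableIn {chi D} fun s => Encodable.encode (initialSegment D s) := by
  classical
  have hD : Nat.RecursiveIn {chi D} (chi D) := .oracle _ rfl
  have happ : Primrec fun n : ℕ => Encodable.encode
      (((Encodable.decode (α := List ℕ) n.unpair.1).getD []) ++ [n.unpair.2]) :=
    Primrec.encode.comp (Primrec.list_concat.comp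
      (Primrec.option_getD.comp (Primrec.decode.comp (Primrec.fst.comp Primrec.unpair))
        (Primrec.const [])) (Primrec.snd.comp Primrec.unpair))
  have h0 : Nat.RecursiveIn {chi D} fun _ : ℕ => Part.some (Encodable.encode ([] : List ℕ)) :=
    RecursiveIn.iff_nat.1 (Computable.const (α := ℕ) _).computableIn
  have hval : Nat.RecursiveIn {chi D} fun n : ℕ => Part.some n.unpair.2.unpair.2 :=
    RecursiveIn.iff_nat.1 (Primrec.computableIn
      (Primrec.snd.comp (Primrec.unpair.comp (Primrec.snd.comp Primrec.unpair))))
  have hidx : Nat.RecursiveIn {chi D} fun n : ℕ => Part.some n.unpair.2.unpair.1 :=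
    RecursiveIn.iff_nat.1 (Primrec.computableIn
      (Primrec.fst.comp (Primrec.unpair.comp (Primrec.snd.comp Primrec.unpair))))
  -- The recursion needs no parameter; `0` is a dummy.
  have hstart : Nat.RecursiveIn {chi D} fun n : ℕ => Part.some (Nat.pair 0 n) :=
    RecursiveIn.iff_nat.1 (Primrec.computableIn (Primrec₂.natPair.comp (.const 0) .id))
  have hprec := Nat.RecursiveIn.prec h0
    ((RecursiveIn.iff_nat.1 happ.computableIn).comp (hval.pair (hD.comp hidx)))
  refine RecursiveIn.iff_nat.2 ((hprec.comp hstart).of_eq fun n => ?_)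
  refine (Part.bind_some _ _).trans ?_
  simp only [Nat.unpair_pair]
  induction n with
  | zero => rfl
  | succ n ih =>
    simp only [ih]
    refine (Part.bind_some _ _).trans ?_
    have hn : (Part.some n >>= chi D) = Part.some (if n ∈ D then 1 else 0) :=
      (Part.bind_some _ _).trans (by simp only [chi])
    simp [hn, Seq.seq, initialSegment, List.range_succ]

/-- A set that is recursively enumerable by a procedure using finite parts of the oracle `D`
is `Σ^0_1(D)`. -/
theorem isSigma_one_of_partrec {P : ℕ × List ℕ →. ℕ} (hP : Partrec P) (D : Set ℕ) :
    IsSigma D 1 {x | ∃ s, (P (x, initialSegment D s)).Dom} := by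
  obtain ⟨c, hc⟩ := Nat.Partrec.Code.exists_code.1 hP
  have hdom : ∀ a, (P a).Dom ↔ ∃ k, (c.evaln k (Encodable.encode a)).isSome = true := by
    intro a
    have : c.eval (Encodable.encode a) = (P a).map Encodable.encode := by
      rw [hc]
      simp only [Encodable.encodek]
      exact Part.bind_some _ _
    rw [← Part.map_Dom Encodable.encode (P a), ← this, Part.dom_iff_mem]
    simp only [Nat.Partrec.Code.evaln_complete, Option.isSome_iff_exists, Option.mem_def]
    exact exists_comm
  -- The witness codes both the length of the oracle segment and a bound on the computation, which
  -- makes the matrix decidable in `D`.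
  let B : Set ℕ := {z | (c.evaln z.unpair.2.unpair.2 (Nat.pair z.unpair.1
    (Encodable.encode (initialSegment D z.unpair.2.unpair.1)))).isSome = true}
  have hB : SetReducible B D := by
    have hsnd : Primrec fun n : ℕ => n.unpair.2 := Primrec.snd.comp Primrec.unpair
    have hfst : Primrec fun n : ℕ => n.unpair.1 := Primrec.fst.comp Primrec.unpair
    have hg : ComputableIn {chi D} fun z : ℕ => Nat.pair z
        (Encodable.encode (initialSegment D z.unpair.2.unpair.1)) := by
      refine RecursiveIn.iff_nat.2 (((RecursiveIn.iff_nat.1 Primrec.id.computableIn).pair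
        ((RecursiveIn.iff_nat.1 (computableIn_initialSegment D)).comp
          (RecursiveIn.iff_nat.1 (hfst.comp hsnd).computableIn))).of_eq fun n => ?_)
      simp [Seq.seq]
    refine setReducible_of_computableIn hg
      (p := fun w => (c.evaln w.unpair.1.unpair.2.unpair.2
        (Nat.pair w.unpair.1.unpair.1 w.unpair.2)).isSome) ?_ fun x => by simp [B]
    exact (Primrec.option_isSome.comp (Nat.Partrec.Code.primrec_evaln.comp
      (((hsnd.comp (hsnd.comp hfst)).pair (.const c)).pair
        (Primrec₂.natPair.comp (hfst.comp hfst) hsnd)))).to_comp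
  refine ⟨B, hB.compl, fun x => ?_⟩
  simp only [Set.mem_ofPred_eq, hdom, B, Nat.unpair_pair]
  constructor
  · rintro ⟨s, k, h⟩
    exact ⟨Nat.pair s k, by simpa using h⟩
  · rintro ⟨y, h⟩
    exact ⟨_, _, h⟩

end HighIso

namespace HighIso

open Nat.Partrec (Code)

/-! ### A computable family of relations that have infinite chains exactly off `O` -/

theorem exists_primrec_code_phi_empty :
    ∃ t : ℕ → Code, Primrec t ∧ ∀ e n, (t e).eval n = phi ∅ e n := by
  obtain ⟨t, ht, h⟩ := exists_primrec_code_eval (G := fun _ => chi ∅)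
    ((Computable.const 0).partrec.of_eq fun x => by simp [chi])
  refine ⟨fun e => .curry (t e) 0, Code.primrec₂_curry.comp ht (.const 0), fun e n => ?_⟩
  rw [Code.eval_curry, h]
  rfl

/-- A program for `{e}^∅`, primitive recursive in `e`. -/
noncomputable def plainCode : ℕ → Code := exists_primrec_code_phi_empty.choose

theorem primrec_plainCode : Primrec plainCode := exists_primrec_code_phi_empty.choose_spec.1

theorem eval_plainCode (e n : ℕ) : (plainCode e).eval n = phi ∅ e n :=
  exists_primrec_code_phi_empty.choose_spec.2 e n

/-- The computation of `{e}^∅(n)` has the result `v` after `s` steps. -/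
noncomputable def stageEval (e n s v : ℕ) : Bool := decide ((plainCode e).evaln s n = some v)

theorem stageEval_mono {e n s s' v : ℕ} (h : s ≤ s') (hv : stageEval e n s v = true) :
    stageEval e n s' v = true := by
  simp only [stageEval, decide_eq_true_eq] at hv ⊢
  exact Code.evaln_mono h hv

theorem mem_phi_empty_iff {e n v : ℕ} : v ∈ phi ∅ e n ↔ ∃ s, stageEval e n s v = true := by
  simp only [← eval_plainCode, Code.evaln_complete, stageEval, decide_eq_true_eq, Option.mem_def]

/-- At stage `s`, the value of `{e}^∅` at the pair `m = (a, b)` has been found to be `0` or `1`,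
and if `a ≠ b` then `a` and `b` have been found to be related. -/
noncomputable def pairSettled (e m s : ℕ) : Bool :=
  (stageEval e m s 0 || stageEval e m s 1) && (decide (m.unpair.1 = m.unpair.2) ||
    (stageEval e m s 1 || stageEval e (Nat.pair m.unpair.2 m.unpair.1) s 1))

theorem pairSettled_mono {e m s s' : ℕ} (h : s ≤ s') (hm : pairSettled e m s = true) :
    pairSettled e m s' = true := by
  simp only [pairSettled, Bool.and_eq_true, Bool.or_eq_true] at hm ⊢
  exact ⟨hm.1.imp (stageEval_mono h) (stageEval_mono h),
    hm.2.imp id (.imp (stageEval_mono h) (stageEval_mono h))⟩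

/-- Two consecutive entries of a sequence which shows that `e ∉ O`. Entries `(0, (a, s))` list
a descending sequence; entries `(m + 1, s)` say that the pair `m` is never settled. -/
noncomputable def refutationStep (e k k' : ℕ) : Bool :=
  decide (k.unpair.1 = k'.unpair.1) &&
    cond (decide (k.unpair.1 = 0))
      (stageEval e (Nat.pair k'.unpair.2.unpair.1 k.unpair.2.unpair.1) k'.unpair.2.unpair.2 1)
      (!pairSettled e (k.unpair.1 - 1) k.unpair.2 && decide (k'.unpair.2 = k.unpair.2 + 1))

theorem primrec_stageEval {α : Type*} [Primcodable α] {e n s v : α → ℕ} (he : Primrec e)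
    (hn : Primrec n) (hs : Primrec s) (hv : Primrec v) :
    Primrec fun x => stageEval (e x) (n x) (s x) (v x) :=
  Primrec.eq.decide.comp (Code.primrec_evaln.comp ((hs.pair (primrec_plainCode.comp he)).pair hn))
    (Primrec.option_some.comp hv)

theorem primrec_unpair_fst {α : Type*} [Primcodable α] {f : α → ℕ} (hf : Primrec f) :
    Primrec fun x => (f x).unpair.1 := Primrec.fst.comp (Primrec.unpair.comp hf)

theorem primrec_unpair_snd {α : Type*} [Primcodable α] {f : α → ℕ} (hf : Primrec f) :
    Primrec fun x => (f x).unpair.2 := Primrec.snd.comp (Primrec.unpair.comp hf)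

theorem primrec_pairSettled {α : Type*} [Primcodable α] {e m s : α → ℕ} (he : Primrec e)
    (hm : Primrec m) (hs : Primrec s) : Primrec fun x => pairSettled (e x) (m x) (s x) :=
  Primrec.and.comp (Primrec.or.comp (primrec_stageEval he hm hs (.const 0))
      (primrec_stageEval he hm hs (.const 1)))
    (Primrec.or.comp (Primrec.eq.decide.comp (primrec_unpair_fst hm) (primrec_unpair_snd hm))
      (Primrec.or.comp (primrec_stageEval he hm hs (.const 1))
        (primrec_stageEval he
          (Primrec₂.natPair.comp (primrec_unpair_snd hm) (primrec_unpair_fst hm)) hs (.const 1))))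

theorem primrec_refutationStep {α : Type*} [Primcodable α] {e k k' : α → ℕ} (he : Primrec e)
    (hk : Primrec k) (hk' : Primrec k') : Primrec fun x => refutationStep (e x) (k x) (k' x) :=
  have h1 := primrec_unpair_fst hk
  have h2 := primrec_unpair_snd hk
  have h2' := primrec_unpair_snd hk'
  Primrec.and.comp (Primrec.eq.decide.comp h1 (primrec_unpair_fst hk'))
    (Primrec.cond (Primrec.eq.decide.comp h1 (.const 0))
      (primrec_stageEval he (Primrec₂.natPair.comp (primrec_unpair_fst h2') (primrec_unpair_fst h2))
        (primrec_unpair_snd h2') (.const 1))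
      (Primrec.and.comp
        (Primrec.not.comp (primrec_pairSettled he (Primrec.nat_sub.comp h1 (.const 1)) h2))
        (Primrec.eq.decide.comp h2' (Primrec.succ.comp h2))))

/-- The tag is constant along the chain. Tag `0` yields a descending sequence; tag `m + 1` says that
pair `m` is unsettled at all stages from some point on, against totality and trichotomy. -/
theorem not_mem_kleeneO_of_refutation {e : ℕ} {k : ℕ → ℕ}
    (hk : ∀ n, refutationStep e (k n) (k (n + 1)) = true) : e ∉ kleeneO := by
  rintro ⟨r, hr, hphi⟩
  have hfst : ∀ n, (k n).unpair.1 = (k 0).unpair.1 := by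
    intro n
    induction n with
    | zero => rfl
    | succ n ih =>
      have := hk n
      simp only [refutationStep, Bool.and_eq_true, decide_eq_true_eq] at this
      rw [← this.1, ih]
  have hval : ∀ a b s, stageEval e (Nat.pair a b) s 1 = true → r a b := by
    intro a b s h
    have := mem_phi_empty_iff.2 ⟨s, h⟩
    rw [hphi] at this
    by_contra hn
    simp [hn] at this
  rcases hw : (k 0).unpair.1 with - | m
  · have hdesc : ∀ n, r (k (n + 1)).unpair.2.unpair.1 (k n).unpair.2.unpair.1 := by
      intro n
      have := hk n
      simp only [refutationStep, hfst, hw, Bool.and_eq_true, decide_true, cond_true] at this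
      exact hval _ _ _ this.2
    exact (wellFounded_iff_isEmpty_descending_chain.1 hr.wf).false
      ⟨fun n => (k n).unpair.2.unpair.1, hdesc⟩
  · have hstep : ∀ n, pairSettled e m ((k 0).unpair.2 + n) = false ∧
        (k n).unpair.2 = (k 0).unpair.2 + n := by
      intro n
      have H : ∀ n, pairSettled e m (k n).unpair.2 = false ∧
          (k (n + 1)).unpair.2 = (k n).unpair.2 + 1 := by
        intro n
        have := hk n
        simpa [refutationStep, hfst, hw] using this
      have H' : (k n).unpair.2 = (k 0).unpair.2 + n := by
        induction n with
        | zero => rfl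
        | succ n ih => rw [(H n).2, ih, Nat.add_assoc]
      exact ⟨H' ▸ (H n).1, H'⟩
    obtain ⟨s, hs⟩ : ∃ s, pairSettled e m s = true := by
      have hm : m = Nat.pair m.unpair.1 m.unpair.2 := (Nat.pair_unpair m).symm
      have h1 : ∀ a b, r a b → ∃ s, stageEval e (Nat.pair a b) s 1 = true := fun a b hab =>
        mem_phi_empty_iff.1 (by rw [hphi]; simp [hab])
      have h2 : ∃ s, (stageEval e m s 0 || stageEval e m s 1) = true := by
        by_cases hab : r m.unpair.1 m.unpair.2
        · obtain ⟨s, hs⟩ := h1 _ _ hab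
          exact ⟨s, by rw [hm, hs, Bool.or_true]⟩
        · obtain ⟨s, hs⟩ := mem_phi_empty_iff.1
            (show 0 ∈ phi ∅ e (Nat.pair m.unpair.1 m.unpair.2) by rw [hphi]; simp [hab])
          exact ⟨s, by rw [hm, hs, Bool.true_or]⟩
      have h3 : ∃ s, (decide (m.unpair.1 = m.unpair.2) ||
          (stageEval e m s 1 || stageEval e (Nat.pair m.unpair.2 m.unpair.1) s 1)) = true := by
        rcases trichotomous_of r m.unpair.1 m.unpair.2 with h | h | h
        · obtain ⟨s, hs⟩ := h1 _ _ h
          rw [← hm] at hs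
          exact ⟨s, by simp [hs]⟩
        · exact ⟨0, by simp [h]⟩
        · obtain ⟨s, hs⟩ := h1 _ _ h
          exact ⟨s, by simp [hs]⟩
      obtain ⟨s, hs⟩ := h2
      obtain ⟨s', hs'⟩ := h3
      refine ⟨max s s', ?_⟩
      simp only [pairSettled, Bool.and_eq_true, Bool.or_eq_true] at hs hs' ⊢
      exact ⟨hs.imp (stageEval_mono (le_max_left _ _)) (stageEval_mono (le_max_left _ _)),
        hs'.imp id (.imp (stageEval_mono (le_max_right _ _)) (stageEval_mono (le_max_right _ _)))⟩
    have := pairSettled_mono (Nat.le_add_left s (k 0).unpair.2) hs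
    rw [(hstep s).1] at this
    exact Bool.false_ne_true this

/-- Once every pair is settled, the program decides a trichotomous relation, so only
well-foundedness can fail. -/
theorem exists_refutation_of_not_mem_kleeneO {e : ℕ} (he : e ∉ kleeneO) :
    ∃ k : ℕ → ℕ, ∀ n, refutationStep e (k n) (k (n + 1)) = true := by
  by_cases hset : ∃ m, ∀ s, pairSettled e m s = false
  · obtain ⟨m, hm⟩ := hset
    exact ⟨fun n => Nat.pair (m + 1) n, fun n => by simp [refutationStep, hm]⟩
  have hset : ∀ m, ∃ s, pairSettled e m s = true := by simpa using hset
  let r : ℕ → ℕ → Prop := fun a b => 1 ∈ phi ∅ e (Nat.pair a b)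
  have hphi : ∀ a b, (r a b → phi ∅ e (Nat.pair a b) = Part.some 1) ∧
      (¬ r a b → phi ∅ e (Nat.pair a b) = Part.some 0) := by
    intro a b
    refine ⟨Part.eq_some_iff.2, fun h => Part.eq_some_iff.2 ?_⟩
    obtain ⟨s, hs⟩ := hset (Nat.pair a b)
    simp only [pairSettled, Bool.and_eq_true, Bool.or_eq_true] at hs
    exact mem_phi_empty_iff.2 ⟨s, hs.1.resolve_right fun h1 => h (mem_phi_empty_iff.2 ⟨s, h1⟩)⟩
  have htri : ∀ a b, a = b ∨ r a b ∨ r b a := by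
    intro a b
    obtain ⟨s, hs⟩ := hset (Nat.pair a b)
    simp only [pairSettled, Bool.and_eq_true, Bool.or_eq_true, Nat.unpair_pair,
      decide_eq_true_eq] at hs
    exact hs.2.imp id (.imp (fun h => mem_phi_empty_iff.2 ⟨s, h⟩)
      fun h => mem_phi_empty_iff.2 ⟨s, h⟩)
  have hwf : ¬ WellFounded r := by
    intro hwf
    -- Transitivity need not be checked: it follows from trichotomy and the absence of cycles.
    refine he ⟨r, { wf := hwf, trichotomous := fun a b h1 h2 => ?_ }, fun a b => ?_⟩
    · exact (htri a b).resolve_right fun h => h.elim h1 h2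
    · split_ifs with h
      exacts [(hphi a b).1 h, (hphi a b).2 h]
  rw [wellFounded_iff_isEmpty_descending_chain, not_isEmpty_iff] at hwf
  obtain ⟨a, ha⟩ := hwf
  choose s hs using fun n => mem_phi_empty_iff.1 (ha n)
  -- Each entry carries the stage confirming its relation to the previous one. The stage in entry
  -- `0` is never inspected, so the truncated subtraction is harmless.
  refine ⟨fun n => Nat.pair 0 (Nat.pair (a n) (s (n - 1))), fun n => ?_⟩
  simp [refutationStep, hs]

end HighIso

namespace HighIso

/-! ### Parity of the number of binary digits -/

/-- The parity of the number of binary digits `1` of `v` below position `n`. -/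
def bitParityTo (v : ℕ) : ℕ → Bool
  | 0 => false
  | n + 1 => bitParityTo v n ^^ v.testBit n

/-- The parity of the number of binary digits `1` of `v`. -/
def bitParity (v : ℕ) : Bool := bitParityTo v v

theorem bitParityTo_eq_bitParity {v n : ℕ} (h : v ≤ n) : bitParityTo v n = bitParity v := by
  induction n, h using Nat.le_induction with
  | base => rfl
  | succ n hn ih =>
    have : v.testBit n = false :=
      Nat.testBit_lt_two_pow (lt_of_le_of_lt hn Nat.lt_two_pow_self)
    rw [bitParityTo, ih, this, Bool.xor_false]

theorem bitParity_xor (v w : ℕ) : bitParity (v ^^^ w) = (bitParity v ^^ bitParity w) := by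
  have H : ∀ n, bitParityTo (v ^^^ w) n = (bitParityTo v n ^^ bitParityTo w n) := by
    intro n
    induction n with
    | zero => rfl
    | succ n ih =>
      simp only [bitParityTo, ih, Nat.testBit_xor]
      cases bitParityTo v n <;> cases bitParityTo w n <;> cases v.testBit n <;>
        cases w.testBit n <;> rfl
  -- The three parities are compared by counting below one common bound.
  have := H (max (v ^^^ w) (max v w))
  rwa [bitParityTo_eq_bitParity (le_max_left _ _), bitParityTo_eq_bitParity (by simp),
    bitParityTo_eq_bitParity (by simp)] at this

theorem bitParity_two_pow (k : ℕ) : bitParity (2 ^ k) = true := by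
  have H : ∀ n, bitParityTo (2 ^ k) n = decide (k < n) := by
    intro n
    induction n with
    | zero => simp [bitParityTo]
    | succ n ih =>
      rw [bitParityTo, ih, Nat.testBit_two_pow]
      rcases lt_trichotomy k n with h | h | h
      · simp [h, h.ne, Nat.lt_succ_of_lt h]
      · simp [h]
      · simp [h.ne', not_lt_of_gt h, not_le_of_gt h]
  rw [bitParity, H, decide_eq_true_eq]
  exact Nat.lt_two_pow_self

theorem exists_testBit_of_bitParity {v : ℕ} (h : bitParity v = true) :
    ∃ k, v.testBit k = true := by
  by_contra! hn
  have H : ∀ n, bitParityTo v n = false := by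
    intro n
    induction n with
    | zero => rfl
    | succ n ih => simp [bitParityTo, ih, hn]
  rw [bitParity, H] at h
  exact Bool.false_ne_true h

/-! ### Odd labellings of the tree of refutations

Finite sequences of natural numbers are numbered by nodes: `0` is the empty sequence, and
`childNode σ k` is the sequence with the number `σ` extended by `k`. -/

/-- The node of the sequence numbered `σ` extended by `k`. -/
def childNode (σ k : ℕ) : ℕ := Nat.pair σ k + 1

theorem childNode_inj {σ τ j k : ℕ} : childNode σ j = childNode τ k ↔ σ = τ ∧ j = k := by
  simp [childNode, Nat.pair_eq_pair]

/-- The sequence numbered `σ` may be extended by `k` in a refutation of `e ∈ O`. -/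
noncomputable def allowedChild (e σ k : ℕ) : Bool :=
  -- For a nonempty sequence, `(σ - 1).unpair.2` is its last entry; at the root any first entry is
  -- admitted.
  decide (σ = 0) || refutationStep e (σ - 1).unpair.2 k

/-- A labelling of the nodes by finite sets of children (given by binary digits) such that the
root has an odd number of children, a node has an odd number of children if and only if it is
itself chosen, and only allowed children are chosen. -/
structure IsOddLabelling (e : ℕ) (c : ℕ → ℕ) : Prop where
  root : bitParity (c 0) = true
  child : ∀ σ k, (c σ).testBit k = bitParity (c (childNode σ k))
  allowed : ∀ σ k, (c σ).testBit k = true → allowedChild e σ k = true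

/-- Choose the single next child at every node of the path and nothing elsewhere: parity is then odd
exactly on the path. -/
theorem exists_isOddLabelling {e : ℕ} {k : ℕ → ℕ}
    (hk : ∀ n, refutationStep e (k n) (k (n + 1)) = true) : ∃ c, IsOddLabelling e c := by
  obtain ⟨s, hs0, hs⟩ : ∃ s : ℕ → ℕ, s 0 = 0 ∧ ∀ n, s (n + 1) = childNode (s n) (k n) :=
    ⟨fun n => Nat.rec 0 (fun m σ => childNode σ (k m)) n, rfl, fun _ => rfl⟩
  have hinj : Function.Injective s := by
    refine StrictMono.injective (strictMono_nat_of_lt_succ fun n => ?_)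
    rw [hs]
    exact Nat.lt_succ_of_le (Nat.left_le_pair _ _)
  -- The path is closed under parents, so children off the path keep the empty label.
  have hchild : ∀ m σ j, s m = childNode σ j → ∃ n, s n = σ ∧ k n = j := by
    intro m σ j h
    cases m with
    | zero => exact absurd (hs0.symm.trans h) (Nat.succ_ne_zero _).symm
    | succ m => exact ⟨m, childNode_inj.1 ((hs m).symm.trans h)⟩
  obtain ⟨c, hc, hc'⟩ : ∃ c : ℕ → ℕ, (∀ n, c (s n) = 2 ^ k n) ∧
      ∀ σ, (¬ ∃ n, s n = σ) → c σ = 0 :=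
    ⟨Function.extend s (fun n => 2 ^ k n) 0, hinj.extend_apply _ _,
      Function.extend_apply' _ _⟩
  refine ⟨c, ⟨?_, fun σ j => ?_, fun σ j h => ?_⟩⟩
  · rw [← hs0, hc, bitParity_two_pow]
  · by_cases hσ : ∃ n, s n = σ
    · obtain ⟨n, rfl⟩ := hσ
      rw [hc, Nat.testBit_two_pow]
      by_cases hj : k n = j
      · rw [← hj, ← hs, hc, bitParity_two_pow, decide_eq_true rfl]
      · rw [hc', decide_eq_false hj]
        · rfl
        · rintro ⟨m, hm⟩
          obtain ⟨n', hn', hk'⟩ := hchild _ _ _ hm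
          exact hj (hinj hn' ▸ hk')
    · rw [hc' _ hσ, hc', Nat.zero_testBit]
      · rfl
      · rintro ⟨m, hm⟩
        obtain ⟨n, hn, -⟩ := hchild _ _ _ hm
        exact hσ ⟨n, hn⟩
  · by_cases hσ : ∃ n, s n = σ
    · obtain ⟨n, rfl⟩ := hσ
      rw [hc, Nat.testBit_two_pow, decide_eq_true_eq] at h
      subst h
      cases n with
      | zero => simp [hs0, allowedChild]
      | succ n => simp [hs, childNode, allowedChild, hk]
    · simp [hc' _ hσ] at h

/-! ### The pair of structures -/

/-- The signature with binary relation symbols numbered by all natural numbers. -/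
def binarySignature : Signature := ⟨fun _ => some 2, fun _ => none⟩

/-- The relations of the structures; the elements `Nat.pair σ v` form the fibre over the node `σ`.
The relations fix the fibres, link the digits of the elements over `σ` with the parity of those over
the children of `σ`, mark the elements over the root of parity `b`, and name the digits for
children that are not allowed. -/
noncomputable def fibreRel (e : ℕ) (b : Bool) (q x y : ℕ) : Bool :=
  if q.unpair.1 = 0 then decide (x.unpair.1 = q.unpair.2)
  else if q.unpair.1 = 1 then decide (y.unpair.1 = childNode x.unpair.1 q.unpair.2) &&
    decide (x.unpair.2.testBit q.unpair.2 = bitParity y.unpair.2)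
  else if q.unpair.1 = 2 then decide (x.unpair.1 = 0) && decide (bitParity x.unpair.2 = b)
  else !allowedChild e x.unpair.1 q.unpair.2 && x.unpair.2.testBit q.unpair.2

/-- The structure with the relations `fibreRel e b`. -/
@[reducible]
noncomputable def fibreStr (e : ℕ) (b : Bool) : Str binarySignature where
  funMap f _ := nomatch f.2
  -- All symbols are binary, so the defaults are never used.
  RelMap k v := fibreRel e b k.1 ((List.ofFn v).getD 0 0) ((List.ofFn v).getD 1 0) = true

/-- Translate each fibre by its label. A digit and the matching child parity flip together, the root
parity flips because its label is odd, and digits of forbidden children stay put. Translation by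
`xor` is its own inverse. -/
theorem nonempty_iso_fibreStr {e : ℕ} {c : ℕ → ℕ} (hc : IsOddLabelling e c) :
    Nonempty (Iso (fibreStr e false) (fibreStr e true)) := by
  let p : ℕ → ℕ := fun x => Nat.pair x.unpair.1 (x.unpair.2 ^^^ c x.unpair.1)
  have hp : Function.Involutive p := fun x => by simp [p]
  have hrel : ∀ q x y, fibreRel e true q (p x) (p y) = fibreRel e false q x y := by
    intro q x y
    simp only [fibreRel, p, Nat.unpair_pair, Nat.testBit_xor, bitParity_xor]
    split_ifs with h0 h1 h2
    · rfl
    · by_cases hy : y.unpair.1 = childNode x.unpair.1 q.unpair.2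
      · rw [hy, ← hc.child]
        cases x.unpair.2.testBit q.unpair.2 <;> cases bitParity y.unpair.2 <;>
          cases (c x.unpair.1).testBit q.unpair.2 <;> rfl
      · simp [hy]
    · by_cases hx : x.unpair.1 = 0
      · rw [hx, hc.root]
        cases bitParity x.unpair.2 <;> rfl
      · simp [hx]
    · by_cases ha : allowedChild e x.unpair.1 q.unpair.2 = true
      · simp [ha]
      · rw [Bool.eq_false_iff.2 (mt (hc.allowed _ _) ha), Bool.xor_false]
  refine ⟨@FirstOrder.Language.Equiv.mk _ _ _ (_) (_) hp.toPerm (fun f _ => nomatch f.2) ?_⟩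
  intro n k v
  have hn : n = 2 := (Option.some_injective _ k.2).symm
  subst hn
  change fibreRel e true _ _ _ = true ↔ fibreRel e false _ _ _ = true
  rw [← hrel]
  rfl

/-- Zeros have no digits and even parity, so each kind of relation, evaluated at zeros, becomes one
clause about their images. -/
theorem isOddLabelling_of_iso {e : ℕ} (g : Iso (fibreStr e false) (fibreStr e true)) :
    (∀ σ, (g.toFun (Nat.pair σ 0)).unpair.1 = σ) ∧
      IsOddLabelling e fun σ => (g.toFun (Nat.pair σ 0)).unpair.2 := by
  have hrel : ∀ q x y, fibreRel e true q (g.toFun x) (g.toFun y) = fibreRel e false q x y := by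
    intro q x y
    rw [Bool.eq_iff_iff]
    exact @FirstOrder.Language.Equiv.map_rel' _ _ _ (_) (_) g 2 ⟨q, rfl⟩ ![x, y]
  have h0 : ∀ σ, (g.toFun (Nat.pair σ 0)).unpair.1 = σ := by
    intro σ
    have := hrel (Nat.pair 0 σ) (Nat.pair σ 0) 0
    simpa [fibreRel] using this
  refine ⟨h0, ?_, fun σ k => ?_, fun σ k hk => ?_⟩
  · have := hrel (Nat.pair 2 0) (Nat.pair 0 0) 0
    simpa [fibreRel, h0, show bitParity 0 = false from rfl] using this
  · have := hrel (Nat.pair 1 k) (Nat.pair σ 0) (Nat.pair (childNode σ k) 0)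
    simpa [fibreRel, h0, bitParity, bitParityTo] using this
  · have := hrel (Nat.pair 3 k) (Nat.pair σ 0) 0
    simpa [fibreRel, h0, hk] using this

end HighIso

namespace HighIso

open Filter

/-! ### Extracting a refutation from an isomorphism -/

/-- The least child chosen at the node `σ` by the labelling read off from `p`. -/
def nextChild (p : ℕ →. ℕ) (σ : ℕ) : Part ℕ :=
  (p (Nat.pair σ 0)).bind fun w => Nat.rfind fun k => Part.some (w.unpair.2.testBit k)

/-- The node at depth `n` of the path of chosen children. -/
def pathNode (p : ℕ →. ℕ) (n : ℕ) : Part ℕ :=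
  n.rec (Part.some 0) fun _ IH => IH.bind fun σ => (nextChild p σ).map (childNode σ)

/-- A procedure that halts if the path of chosen children has a node of depth `n` with a
chosen and allowed child. -/
noncomputable def pathCheck (e : ℕ) (p : ℕ →. ℕ) (n : ℕ) : Part ℕ :=
  (pathNode p n).bind fun σ => (nextChild p σ).bind fun k =>
    bif allowedChild e σ k then Part.some 0 else Part.none

theorem nextChild_eventually {ι : Type*} {l : Filter ι} {p : ℕ →. ℕ} {q : ι → ℕ →. ℕ}
    (H : ∀ n y, y ∈ p n → ∀ᶠ s in l, y ∈ q s n) {σ y : ℕ} (hy : y ∈ nextChild p σ) :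
    ∀ᶠ s in l, y ∈ nextChild (q s) σ := by
  obtain ⟨w, hw, hy⟩ := Part.mem_bind_iff.1 hy
  filter_upwards [H _ _ hw] with s hs using Part.mem_bind_iff.2 ⟨w, hs, hy⟩

theorem pathNode_eventually {ι : Type*} {l : Filter ι} {p : ℕ →. ℕ} {q : ι → ℕ →. ℕ}
    (H : ∀ n y, y ∈ p n → ∀ᶠ s in l, y ∈ q s n) {n y : ℕ} (hy : y ∈ pathNode p n) :
    ∀ᶠ s in l, y ∈ pathNode (q s) n := by
  induction n generalizing y with
  | zero => exact Eventually.of_forall fun _ => hy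
  | succ n ih =>
    obtain ⟨σ, hσ, hy⟩ := Part.mem_bind_iff.1 hy
    obtain ⟨k, hk, rfl⟩ := (Part.mem_map_iff _).1 hy
    filter_upwards [ih hσ, nextChild_eventually H hk] with s h1 h2
    exact Part.mem_bind_iff.2 ⟨σ, h1, (Part.mem_map_iff _).2 ⟨k, h2, rfl⟩⟩

theorem pathCheck_eventually {ι : Type*} {l : Filter ι} {e : ℕ} {p : ℕ →. ℕ} {q : ι → ℕ →. ℕ}
    (H : ∀ n y, y ∈ p n → ∀ᶠ s in l, y ∈ q s n) {n y : ℕ} (hy : y ∈ pathCheck e p n) :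
    ∀ᶠ s in l, y ∈ pathCheck e (q s) n := by
  obtain ⟨σ, hσ, hy⟩ := Part.mem_bind_iff.1 hy
  obtain ⟨k, hk, hy⟩ := Part.mem_bind_iff.1 hy
  filter_upwards [pathNode_eventually H hσ, nextChild_eventually H hk] with s h1 h2
  exact Part.mem_bind_iff.2 ⟨σ, h1, Part.mem_bind_iff.2 ⟨k, h2, hy⟩⟩

/-- A halting check consults finitely much of the oracle; conversely, an initial segment is a
restriction of the full oracle, so its computations persist. -/
theorem pathCheck_phi_dom_iff {e i n : ℕ} {D : Set ℕ} :
    (pathCheck e (phi D i) n).Dom ↔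
      ∃ s, (pathCheck e ((OCode.ofNat i).eval (oracleOf (initialSegment D s))) n).Dom := by
  simp only [Part.dom_iff_mem]
  constructor
  · rintro ⟨y, hy⟩
    obtain ⟨s, hs⟩ := (pathCheck_eventually (fun _ _ => OCode.eval_eventually
      (fun _ _ => eventually_mem_initialSegment) (OCode.ofNat i)) hy).exists
    exact ⟨s, y, hs⟩
  · rintro ⟨s, y, hy⟩
    exact ⟨y, eventually_pure.1 (pathCheck_eventually (l := pure ()) (q := fun _ => phi D i)
      (fun _ _ h => eventually_pure.2
        (OCode.eval_mono (fun _ _ => mem_chi_of_mem_initialSegment) _ h)) hy)⟩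

theorem not_mem_kleeneO_of_pathCheck {e : ℕ} {p : ℕ →. ℕ} (h : ∀ n, (pathCheck e p n).Dom) :
    e ∉ kleeneO := by
  have H : ∀ n, ∃ σ ∈ pathNode p n, ∃ k ∈ nextChild p σ, allowedChild e σ k = true := by
    intro n
    obtain ⟨y, hy⟩ := Part.dom_iff_mem.1 (h n)
    obtain ⟨σ, hσ, hy⟩ := Part.mem_bind_iff.1 hy
    obtain ⟨k, hk, hy⟩ := Part.mem_bind_iff.1 hy
    refine ⟨σ, hσ, k, hk, ?_⟩
    by_contra ha
    rw [Bool.not_eq_true] at ha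
    rw [ha] at hy
    exact Part.notMem_none _ hy
  choose σ hσ k hk ha using H
  refine not_mem_kleeneO_of_refutation (k := k) fun n => ?_
  -- The separate checks fit into one path because the computed nodes and children are unique.
  have hnext : σ (n + 1) = childNode (σ n) (k n) :=
    Part.mem_unique (hσ (n + 1))
      (Part.mem_bind_iff.2 ⟨_, hσ n, (Part.mem_map_iff _).2 ⟨_, hk n, rfl⟩⟩)
  -- The shift skips the root: at depth `n + 1` the check compares the entries `k n` and `k (n +
  -- 1)`.
  have := ha (n + 1)
  simpa [hnext, allowedChild, childNode] using this

/-- Oddness propagates: an odd node has a chosen child, and a chosen child is odd. -/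
theorem pathCheck_dom_of_isOddLabelling {e : ℕ} {g : ℕ → ℕ}
    (hg : IsOddLabelling e fun σ => (g (Nat.pair σ 0)).unpair.2) (n : ℕ) :
    (pathCheck e g n).Dom := by
  have hnext : ∀ σ, bitParity (g (Nat.pair σ 0)).unpair.2 = true →
      ∃ k ∈ nextChild g σ, (g (Nat.pair σ 0)).unpair.2.testBit k = true := by
    intro σ hσ
    obtain ⟨j, hj⟩ := exists_testBit_of_bitParity hσ
    obtain ⟨k, hk⟩ := Part.dom_iff_mem.1 (Nat.rfind_dom.2
      ⟨j, Part.mem_some_iff.2 hj.symm, fun _ => trivial⟩ :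
        (Nat.rfind fun k => Part.some ((g (Nat.pair σ 0)).unpair.2.testBit k)).Dom)
    exact ⟨k, Part.mem_bind_iff.2 ⟨_, Part.mem_some _, hk⟩,
      (Part.mem_some_iff.1 (Nat.rfind_spec hk)).symm⟩
  have hpath : ∃ σ ∈ pathNode g n, bitParity (g (Nat.pair σ 0)).unpair.2 = true := by
    induction n with
    | zero => exact ⟨0, Part.mem_some _, hg.root⟩
    | succ n ih =>
      obtain ⟨σ, hσ, hpar⟩ := ih
      obtain ⟨k, hk, hbit⟩ := hnext σ hpar
      exact ⟨_, Part.mem_bind_iff.2 ⟨σ, hσ, (Part.mem_map_iff _).2 ⟨k, hk, rfl⟩⟩,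
        (hg.child σ k).symm.trans hbit⟩
  obtain ⟨σ, hσ, hpar⟩ := hpath
  obtain ⟨k, hk, hbit⟩ := hnext σ hpar
  refine Part.dom_iff_mem.2 ⟨0, Part.mem_bind_iff.2 ⟨σ, hσ, Part.mem_bind_iff.2 ⟨k, hk, ?_⟩⟩⟩
  simp [hg.allowed σ k hbit]

/-! ### Computability of the structures and of the extraction -/

theorem primrec₂_testBit : Primrec₂ Nat.testBit := by
  have hpow : Primrec fun k : ℕ => 2 ^ k := by
    refine (Primrec.nat_rec₁ 1 (Primrec.nat_mul.comp₂ (Primrec₂.const 2) Primrec₂.right)).of_eq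
      fun n => ?_
    induction n with
    | zero => rfl
    | succ n ih => simp only [ih, Nat.pow_succ']
  have h : Primrec₂ fun v k : ℕ => decide (v / 2 ^ k % 2 = 1) :=
    Primrec.eq.decide.comp (Primrec.nat_mod.comp
      (Primrec.nat_div.comp .fst (hpow.comp .snd)) (.const 2)) (.const 1)
  exact h.of_eq fun v k => Nat.testBit_eq_decide_div_mod_eq.symm

theorem primrec_bitParity : Primrec bitParity := by
  have h : Primrec fun v : ℕ => (Nat.rec false (fun n b => b ^^ v.testBit n) v : Bool) :=
    Primrec.nat_rec' .id (.const false)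
      ((Primrec.dom_bool₂ xor).comp₂ (Primrec.snd.comp₂ Primrec₂.right)
        (primrec₂_testBit.comp₂ Primrec₂.left (Primrec.fst.comp₂ Primrec₂.right)))
  refine h.of_eq fun v => ?_
  have : ∀ n, (Nat.rec false (fun n b => b ^^ v.testBit n) n : Bool) = bitParityTo v n := by
    intro n
    induction n with
    | zero => rfl
    | succ n ih => simp only [ih, bitParityTo]
  exact this v

theorem primrec_childNode {α : Type*} [Primcodable α] {σ k : α → ℕ} (hσ : Primrec σ)
    (hk : Primrec k) : Primrec fun x => childNode (σ x) (k x) :=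
  Primrec.succ.comp (Primrec₂.natPair.comp hσ hk)

theorem primrec_allowedChild {α : Type*} [Primcodable α] {e σ k : α → ℕ} (he : Primrec e)
    (hσ : Primrec σ) (hk : Primrec k) : Primrec fun x => allowedChild (e x) (σ x) (k x) :=
  Primrec.or.comp (Primrec.eq.decide.comp hσ (.const 0))
    (primrec_refutationStep he (primrec_unpair_snd (Primrec.nat_sub.comp hσ (.const 1))) hk)

theorem primrec_fibreRel {α : Type*} [Primcodable α] {e q x y : α → ℕ} (b : Bool) (he : Primrec e)
    (hq : Primrec q) (hx : Primrec x) (hy : Primrec y) :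
    Primrec fun a => fibreRel (e a) b (q a) (x a) (y a) :=
  have q1 := primrec_unpair_fst hq
  have q2 := primrec_unpair_snd hq
  have x1 := primrec_unpair_fst hx
  have x2 := primrec_unpair_snd hx
  have bit := primrec₂_testBit.comp x2 q2
  .ite (Primrec.eq.comp q1 (.const 0)) (Primrec.eq.decide.comp x1 q2) <|
  .ite (Primrec.eq.comp q1 (.const 1))
    (Primrec.and.comp
      (Primrec.eq.decide.comp (primrec_unpair_fst hy) (primrec_childNode x1 q2))
      (Primrec.eq.decide.comp bit (primrec_bitParity.comp (primrec_unpair_snd hy)))) <|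
  .ite (Primrec.eq.comp q1 (.const 2))
    (Primrec.and.comp (Primrec.eq.decide.comp x1 (.const 0))
      (Primrec.eq.decide.comp (primrec_bitParity.comp x2) (.const b)))
    (Primrec.and.comp (Primrec.not.comp (primrec_allowedChild he x1 q2)) bit)

theorem partrec_relEval_fibreStr (b : Bool) :
    Partrec₂ fun e p => (fibreStr e b).relEval p := by
  have hget : ∀ i, Primrec fun a : ℕ × ℕ × List ℕ => a.2.2.getD i 0 := fun i =>
    (Primrec.list_getD 0).comp (Primrec.snd.comp .snd) (.const i)
  have hrel : Computable fun a : ℕ × ℕ × List ℕ =>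
      fibreRel a.1 b a.2.1 (a.2.2.getD 0 0) (a.2.2.getD 1 0) :=
    (primrec_fibreRel b .fst (Primrec.fst.comp .snd) (hget 0) (hget 1)).to_comp
  have hlen : Computable fun a : ℕ × ℕ × List ℕ => decide (2 = a.2.2.length) :=
    (Primrec.eq.decide.comp (.const 2)
      (Primrec.list_length.comp (Primrec.snd.comp .snd))).to_comp
  refine (Partrec.cond hlen hrel.partrec Partrec.none).of_eq fun ⟨e, q, v⟩ => ?_
  by_cases hv : 2 = v.length
  · have h : binarySignature.relArity q = some v.length := congrArg some hv
    refine Eq.trans ?_ (dif_pos h).symm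
    simp only [decide_eq_true hv, cond_true]
    refine congrArg Part.some (Bool.eq_iff_iff.2 ?_)
    refine Iff.trans ?_ (@decide_eq_true_iff _ (_)).symm
    change _ ↔ fibreRel e b q ((List.ofFn v.get).getD 0 0) ((List.ofFn v.get).getD 1 0) = true
    rw [List.ofFn_get]
  · have h : ¬ binarySignature.relArity q = some v.length := fun h => hv (Option.some_injective _ h)
    refine Eq.trans ?_ (dif_neg h).symm
    simp [hv]

/-- Only the program for the relations depends on `e`, and it arises by currying a single program.
-/
theorem exists_computable_index (b : Bool) :
    ∃ i : ℕ → ℕ, Computable i ∧ ∀ e, (fibreStr e b).IsIndex (i e) := by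
  obtain ⟨r, hr⟩ := Nat.Partrec.Code.exists_code.1
    (Computable.const (some 2) : Computable binarySignature.relArity)
  obtain ⟨f, hf⟩ := Nat.Partrec.Code.exists_code.1
    (Computable.const none : Computable binarySignature.funArity)
  obtain ⟨c, hc⟩ := Nat.Partrec.Code.exists_code.1 (partrec_relEval_fibreStr b)
  obtain ⟨d, hd⟩ := Nat.Partrec.Code.exists_code.1
    (Partrec.none : Partrec fun _ : ℕ × List ℕ => (Part.none : Part ℕ))
  refine ⟨fun e => Encodable.encode (r, f, c.curry e, d), ?_, fun e => ⟨_, _, _, _, rfl, hr, hf,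
    ?_, ?_⟩⟩
  · exact Computable.encode.comp ((Computable.const r).pair ((Computable.const f).pair
      ((Nat.Partrec.Code.primrec₂_curry.to_comp.comp (Computable.const c) Computable.id).pair
        (Computable.const d))))
  · funext n
    rw [Nat.Partrec.Code.eval_curry, hc]
    simp only [Encodable.decode_prod_val, Nat.unpair_pair]
    simp
  · exact hd

theorem partrec_nextChild {α : Type*} [Primcodable α] {P : α → ℕ →. ℕ} (hP : Partrec₂ P) :
    Partrec₂ fun a σ => nextChild (P a) σ := by
  have hval : Partrec fun x : α × ℕ => P x.1 (Nat.pair x.2 0) :=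
    hP.comp .fst (Primrec₂.natPair.to_comp.comp .snd (.const 0))
  have hbit : Computable₂ fun (x : (α × ℕ) × ℕ) (k : ℕ) => x.2.unpair.2.testBit k :=
    primrec₂_testBit.to_comp.comp
      ((Computable.snd.comp Computable.unpair).comp (Computable.snd.comp .fst)) .snd
  exact hval.bind (Partrec.rfind hbit.partrec₂)

theorem partrec_pathNode {α : Type*} [Primcodable α] {P : α → ℕ →. ℕ} (hP : Partrec₂ P) {n : α → ℕ}
    (hn : Computable n) : Partrec fun a => pathNode (P a) (n a) := by
  have hstep : Partrec₂ fun (a : α) (p : ℕ × ℕ) => (nextChild (P a) p.2).map (childNode p.2) := by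
    have h1 : Partrec fun x : α × ℕ × ℕ => nextChild (P x.1) x.2.2 :=
      (partrec_nextChild hP).comp .fst (Computable.snd.comp .snd)
    have h2 : Computable₂ fun (x : α × ℕ × ℕ) (k : ℕ) => childNode x.2.2 k :=
      (primrec_childNode (Primrec.snd.comp (Primrec.snd.comp .fst)) .snd).to_comp
    exact h1.map h2
  exact Partrec.nat_rec (g := fun _ => Part.some 0) hn (Computable.const 0).partrec hstep

theorem computable_allowedChild {α : Type*} [Primcodable α] {e σ k : α → ℕ} (he : Computable e)
    (hσ : Computable σ) (hk : Computable k) :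
    Computable fun x => allowedChild (e x) (σ x) (k x) := by
  have hprim : Computable fun y : ℕ × ℕ × ℕ => allowedChild y.1 y.2.1 y.2.2 :=
    (primrec_allowedChild .fst (Primrec.fst.comp .snd) (Primrec.snd.comp .snd)).to_comp
  exact hprim.comp (he.pair (hσ.pair hk))

theorem partrec_pathCheck {α : Type*} [Primcodable α] {P : α → ℕ →. ℕ} (hP : Partrec₂ P)
    {e n : α → ℕ} (he : Computable e) (hn : Computable n) :
    Partrec fun a => pathCheck (e a) (P a) (n a) := by
  have hallowed : Computable fun x : (α × ℕ) × ℕ => allowedChild (e x.1.1) x.1.2 x.2 :=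
    computable_allowedChild (he.comp (Computable.fst.comp .fst)) (Computable.snd.comp .fst) .snd
  have hzero : Partrec fun _ : (α × ℕ) × ℕ => Part.some 0 := (Computable.const 0).partrec
  have hnone : Partrec fun _ : (α × ℕ) × ℕ => (Part.none : Part ℕ) := Partrec.none
  have htest : Partrec₂ fun (x : α × ℕ) (k : ℕ) =>
      bif allowedChild (e x.1) x.2 k then Part.some 0 else (Part.none : Part ℕ) :=
    Partrec.cond hallowed hzero hnone
  have hnext : Partrec fun x : α × ℕ => nextChild (P x.1) x.2 := partrec_nextChild hP
  have hinner : Partrec₂ fun (a : α) (σ : ℕ) => (nextChild (P a) σ).bind fun k =>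
      bif allowedChild (e a) σ k then Part.some 0 else Part.none := hnext.bind htest
  exact (partrec_pathNode hP hn).bind hinner

/-! ### The complexity of `O` over degrees that are high for isomorphism -/

/-- The pairs `(e, i)` such that `{i}^D` yields a refutation of `e ∈ O`. -/
def refutingPairs (D : Set ℕ) : Set ℕ :=
  {z | ∀ n, (pathCheck z.unpair.1 (phi D z.unpair.2) n).Dom}

theorem isPi_two_refutingPairs (D : Set ℕ) : IsPi D 2 (refutingPairs D) := by
  obtain ⟨t, ht, hteval⟩ := exists_primrec_code_eval
    (G := fun l => oracleOf ((Encodable.decode (α := List ℕ) l).getD []))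
    (Computable.ofOption (Primrec.list_getElem?.comp (Primrec.option_getD.comp
      (Primrec.decode.comp .fst) (.const [])) .snd).to_comp)
  have hphi : Partrec₂ fun (a : ℕ × List ℕ) x =>
      (OCode.ofNat a.1.unpair.1.unpair.2).eval (oracleOf a.2) x := by
    refine (Nat.Partrec.Code.eval_part.comp
      (g := fun a : (ℕ × List ℕ) × ℕ => t a.1.1.unpair.1.unpair.2)
      (h := fun a => Nat.pair (Encodable.encode a.1.2) a.2)
      (ht.comp (primrec_unpair_snd (primrec_unpair_fst (Primrec.fst.comp .fst)))).to_comp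
      (Primrec₂.natPair.comp (Primrec.encode.comp (Primrec.snd.comp .fst)) .snd).to_comp).of_eq
      fun a => ?_
    simp [hteval]
  have hP : Partrec fun a : ℕ × List ℕ => pathCheck a.1.unpair.1.unpair.1
      ((OCode.ofNat a.1.unpair.1.unpair.2).eval (oracleOf a.2)) a.1.unpair.2 :=
    partrec_pathCheck hphi
      (primrec_unpair_fst (primrec_unpair_fst .fst)).to_comp (primrec_unpair_snd .fst).to_comp
  -- The complement of the refuting pairs asks for a depth at which the check diverges, and halting
  -- is `Σ_1(D)`.
  refine ⟨{w | (pathCheck w.unpair.1.unpair.1 (phi D w.unpair.1.unpair.2) w.unpair.2).Dom}ᶜ,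
    ?_, fun x => ?_⟩
  · rw [compl_compl]
    simp only [pathCheck_phi_dom_iff]
    exact isSigma_one_of_partrec hP D
  · simp [refutingPairs]

theorem mem_refutingPairs_of_iso {D : Set ℕ} {e i : ℕ}
    (g : Iso (fibreStr e false) (fibreStr e true)) (hg : phi D i = (g.toFun : ℕ →. ℕ)) :
    Nat.pair e i ∈ refutingPairs D := by
  intro n
  simp only [Nat.unpair_pair, hg]
  exact pathCheck_dom_of_isOddLabelling (isOddLabelling_of_iso g).2 n

theorem not_mem_kleeneO_of_mem_refutingPairs {D : Set ℕ} {e i : ℕ}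
    (h : Nat.pair e i ∈ refutingPairs D) : e ∉ kleeneO :=
  not_mem_kleeneO_of_pathCheck (p := phi D i) fun n => by simpa using h n

theorem nonempty_iso_of_not_mem_kleeneO {e : ℕ} (he : e ∉ kleeneO) :
    Nonempty (Iso (fibreStr e false) (fibreStr e true)) := by
  obtain ⟨k, hk⟩ := exists_refutation_of_not_mem_kleeneO he
  obtain ⟨c, hc⟩ := exists_isOddLabelling hk
  exact nonempty_iso_fibreStr hc

theorem Degree.setReducible_of_mem {d : Degree} {D E : Set ℕ} (hD : D ∈ d) (hE : E ∈ d) :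
    SetReducible D E :=
  (Quotient.exact (Eq.trans hD (Eq.symm hE) : deg D = deg E) : TuringEquivalent _ _).1

theorem isPi_three_kleeneO {d : Degree} (h : d.IsHighForIsomorphism) {D : Set ℕ} (hD : D ∈ d) :
    IsPi D 3 kleeneO := by
  refine ⟨refutingPairs D, isPi_two_refutingPairs D, fun e => ⟨fun he => ?_, ?_⟩⟩
  · have hcomp : ∀ b, (fibreStr e b).IsComputable := fun b =>
      have ⟨i, _, hi⟩ := exists_computable_index b
      (Str.isComputable_iff_exists_index _).2 ⟨i e, hi e⟩
    obtain ⟨g, E, hE, hg⟩ := h _ _ _ (hcomp false) (hcomp true)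
      (nonempty_iso_of_not_mem_kleeneO he)
    -- The isomorphism is computed from some member of the degree; that oracle is replaced by `D`.
    have hg' : RecursiveIn {chi D} (g.toFun : ℕ →. ℕ) :=
      hg.subst fun f hf => by
        rw [Set.mem_singleton_iff.1 hf]
        exact d.setReducible_of_mem hE hD
    obtain ⟨i, hi⟩ := (recursiveIn_iff_exists_phi D _).1 hg'
    exact ⟨i, mem_refutingPairs_of_iso g hi⟩
  · rintro ⟨i, hi⟩
    exact not_mem_kleeneO_of_mem_refutingPairs hi

/-- The uniform procedure supplies the program to be checked, so the complement of `O` is a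
computable preimage of the refuting pairs. -/
theorem isSigma_two_kleeneO {d : Degree} (h : d.IsUniformlyHighForIsomorphism) {D : Set ℕ}
    (hD : D ∈ d) : IsSigma D 2 kleeneO := by
  obtain ⟨E, hE, f, hf, hiso⟩ := h
  obtain ⟨i, hi, hi'⟩ := exists_computable_index false
  obtain ⟨j, hj, hj'⟩ := exists_computable_index true
  have hF : Computable fun e => Nat.pair e (f (i e) (j e)) :=
    Primrec₂.natPair.to_comp.comp Computable.id (hf.comp hi hj)
  convert (IsSigma.preimage (isPi_two_refutingPairs E) hF).mono (d.setReducible_of_mem hE hD)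
  ext e
  rw [Set.mem_preimage, Set.mem_compl_iff, iff_not_comm]
  refine ⟨not_mem_kleeneO_of_mem_refutingPairs, fun he => ?_⟩
  obtain ⟨g, hg⟩ := hiso _ _ _ _ _ (hi' e) (hj' e) (nonempty_iso_of_not_mem_kleeneO he)
  exact mem_refutingPairs_of_iso g hg

end HighIso

theorem mainTheorem5 (d : HighIso.Degree) :
    (d.IsHighForIsomorphism →
      ∀ D ∈ d, HighIso.IsArithmeticalOver D HighIso.kleeneO ∧
        HighIso.IsPi D 3 HighIso.kleeneO ∧
        HighIso.SetReducible HighIso.kleeneO (HighIso.jump^[3] D)) ∧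
    (d.IsUniformlyHighForIsomorphism →
      ∀ D ∈ d, HighIso.IsArithmeticalOver D HighIso.kleeneO ∧
        HighIso.IsSigma D 2 HighIso.kleeneO ∧
        HighIso.SetReducible HighIso.kleeneO (HighIso.jump^[2] D)) := by
  refine ⟨fun h D hD => ?_, fun h D hD => ?_⟩
  · have hpi := HighIso.isPi_three_kleeneO h hD
    refine ⟨⟨4, hpi.isSigma_succ⟩, hpi, ?_⟩
    -- The third jump decides the `Σ_3` complement, hence also `O`.
    rw [← compl_compl HighIso.kleeneO]
    exact (HighIso.IsSigma.setReducible_jump_iterate hpi).compl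
  · have hsigma := HighIso.isSigma_two_kleeneO h hD
    exact ⟨⟨2, hsigma⟩, hsigma, hsigma.setReducible_jump_iterate⟩
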